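/- Let $K$ be a field and let $f\in K(z)$ be a separable rational function (that is, $f'\neq 0$) of degree $d\ge 2$. Let $t$ be transcendental over $K$, fix a separable closure $K(t)^{\mathrm{sep}}$ of $K(t)$, and let $K^{\mathrm{sep}}$ be the separable closure of $K$ in it. Let $f^{-n}(t)\subseteq K(t)^{\mathrm{sep}}$ be the set of solutions $x$ of $f^n(x)=t$, where $f^n$ is the $n$-th iterate, and write $f^{-1}(t)=\{t_1,\dots,t_d\}$. A system of paths $\Lambda=(\lambda_i)_{i=1}^d$ consists of $K^{\mathrm{sep}}$-automorphisms $\lambda_i$ of $K(t)^{\mathrm{sep}}=K(t_i)^{\mathrm{sep}}$ with $\lambda_i(t)=t_i$. It identifies the $d$-adic tree $T$ of finite words over $\{1,\dots,d\}$ with the tree of preimages $\bigsqcup_{n\ge 0}f^{-n}(t)$, the word $i_1\cdots i_n$ corresponding to $\lambda_{i_1}(\cdots\lambda_{i_n}(t)\cdots)$. For a field $K\subseteq F\subseteq K^{\mathrm{sep}}$, let $G_\infty(F,f,t)\le \mathrm{Aut}\,T$ be the image of the action $\rho:\mathrm{Gal}(K(t)^{\mathrm{sep}}/F(t))\to\mathrm{Aut}\,T$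 on the tree of preimages, transported by this identification. For $g\in\mathrm{Aut}\,T$ and $v\in T$, the section $g|_v\in\mathrm{Aut}\,T$ is defined by $g(vw)=g(v)\,g|_v(w)$ for all words $w$. A subgroup of $\mathrm{Aut}\,T$ is self-similar if it contains all sections of its elements. For self-similar subgroups $1\ne H\trianglelefteq G\le\mathrm{Aut}\,T$ put $$G_H:=\{g\in G\mid (g|_v)(g|_w)^{-1}\in H\text{ for all }v,w\in T\}.$$ For $1\le n\le\infty$ let $K_n(f,t)$ be the field generated over $K(t)$ by all the sets $f^{-k}(t)$ with $k\le n$ ($k$ finite), and let $L_n:=K^{\mathrm{sep}}\cap K_n(f,t)$. Then systems of paths exist, and for every system of paths and every $1\le n\le\infty$ the following holds: $1\ne G_\infty(L_n,f,t)\trianglelefteq G_\infty(K,f,t)$ are self-similar subgroups of $\mathrm{Aut}\,T$, so that $$G_n^K:=G_\infty(K,f,t)_{G_\infty(L_n,f,t)}$$ is defined, and $$G_\infty(K,f,t)=G_n^K .$$ -/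

import Mathlib

namespace Arboreal

/-! ### The rooted tree of words and its automorphisms -/

/-- The automorphism group of the rooted tree whose vertices are the finite words over `X`
(the root is the empty word, the `n`th level consists of the words of length `n`, and `w` is a
descendant of `v` iff `v` is a prefix of `w`). For `X = Fin d` this is the `d`-adic tree. -/
def TreeAut (X : Type*) : Subgroup (Equiv.Perm (List X)) where
  carrier := {g | (∀ v, (g v).length = v.length) ∧ ∀ v w, g v <+: g w ↔ v <+: w}
  one_mem' := by simp
  mul_mem' := by
    rintro a b ⟨ha, ha'⟩ ⟨hb, hb'⟩
    exact ⟨fun v => by simp [ha, hb], fun v w => by simp [ha', hb']⟩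
  inv_mem' := by
    rintro a ⟨ha, ha'⟩
    refine ⟨fun v => ?_, fun v w => ?_⟩
    · rw [← ha, Equiv.Perm.inv_def, Equiv.apply_symm_apply]
    · rw [← ha', Equiv.Perm.inv_def, Equiv.apply_symm_apply, Equiv.apply_symm_apply]

namespace TreeAut

variable {X : Type*}

theorem append_drop (g : TreeAut X) (v w : List X) :
    g.1 v ++ (g.1 (v ++ w)).drop v.length = g.1 (v ++ w) := by
  obtain ⟨u, hu⟩ := (g.2.2 v (v ++ w)).2 (List.prefix_append v w)
  rw [← hu, List.drop_left' (g.2.1 v)]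

/-- The section `g|_v` of `g` at the vertex `v`: the automorphism with
`g (v w) = g (v) g|_v (w)` for all words `w`, see `apply_append`. -/
def sec (g : TreeAut X) (v : List X) : TreeAut X :=
  ⟨{  toFun := fun w => (g.1 (v ++ w)).drop v.length
      invFun := fun w => (g.1.symm (g.1 v ++ w)).drop v.length
      left_inv := fun w => by
        simp only [append_drop, Equiv.symm_apply_apply, List.drop_left]
      right_inv := fun w => by
        have h : v <+: g.1.symm (g.1 v ++ w) := by
          rw [← g.2.2, Equiv.apply_symm_apply]
          exact List.prefix_append _ _
        obtain ⟨u, hu⟩ := h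
        simp only [← hu, List.drop_left]
        rw [hu, Equiv.apply_symm_apply, List.drop_left' (g.2.1 v)] },
    by
      refine ⟨fun w => ?_, fun w u => ?_⟩
      · simp [g.2.1]
      · have h := g.2.2 (v ++ w) (v ++ u)
        rw [← append_drop g v w, ← append_drop g v u] at h
        simpa [List.prefix_append_right_inj] using h⟩

theorem apply_append (g : TreeAut X) (v w : List X) :
    g.1 (v ++ w) = g.1 v ++ (sec g v).1 w :=
  (append_drop g v w).symm

end TreeAut

/-- A subgroup of the automorphism group of the tree is self-similar if it contains all the
sections of its elements. -/
def IsSelfSimilar {X : Type*} (G : Subgroup (TreeAut X)) : Prop :=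
  ∀ g ∈ G, ∀ v : List X, TreeAut.sec g v ∈ G

/-- `1 ≠ H ⊴ G` are self-similar subgroups of the automorphism group of the tree: the standing
assumption under which the group `G_H` is formed. -/
structure IsSelfSimilarPair {X : Type*} (G H : Subgroup (TreeAut X)) : Prop where
  ne_bot : H ≠ ⊥
  le : H ≤ G
  normal : (H.subgroupOf G).Normal
  selfSimilar_left : IsSelfSimilar G
  selfSimilar_right : IsSelfSimilar H

/-- The group `G_H = {g ∈ G | (g|_v) (g|_w)⁻¹ ∈ H for all vertices v, w}` (its underlying set).
As `H` is normal in `G` and `G` is self-similar, the condition does not depend on whether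
automorphisms are composed from left to right or from right to left. -/
def intermediate {X : Type*} (G H : Subgroup (TreeAut X)) : Set (TreeAut X) :=
  {g | g ∈ G ∧ ∀ v w : List X, TreeAut.sec g v * (TreeAut.sec g w)⁻¹ ∈ H}

/-! ### Rational functions and trees of preimages -/

section Preimages

variable {K Ω : Type*} [Field K] [Field Ω] [Algebra K Ω]

/-- The degree of a rational function as a self-map of the projective line. -/
noncomputable def ratDegree (f : RatFunc K) : ℕ :=
  max f.num.natDegree f.denom.natDegree

/-- The rational function `f` is separable: its formal derivative does not vanish (the
numerator of `f'` is nonzero). -/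
def IsSeparableMap (f : RatFunc K) : Prop :=
  f.num.derivative * f.denom - f.num * f.denom.derivative ≠ 0

/-- The value `f(x)`. At a pole this is `0`; this never matters for the sets `f⁻ⁿ(t)` with
`t` transcendental over `K`, as no point over `t` is algebraic over `K` and so neither it nor
any of its iterated images is a pole of `f`, while the iterates of `0` are algebraic. -/
noncomputable def value (f : RatFunc K) (x : Ω) : Ω :=
  Polynomial.aeval x f.num / Polynomial.aeval x f.denom

/-- The set of vertices of the tree of preimages `⨆ₙ f⁻ⁿ(t)` (disjoint union). -/
def PreimageTree (f : RatFunc K) (t : Ω) : Type _ :=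
  {p : ℕ × Ω // (value f)^[p.1] p.2 = t}

theorem value_map (f : RatFunc K) (σ : Ω ≃ₐ[K] Ω) (x : Ω) :
    value f (σ x) = σ (value f x) := by
  simp only [value, map_div₀]
  rw [← AlgEquiv.coe_toAlgHom, Polynomial.aeval_algHom_apply, Polynomial.aeval_algHom_apply]

theorem value_iterate_map (f : RatFunc K) (σ : Ω ≃ₐ[K] Ω) (n : ℕ) (x : Ω) :
    (value f)^[n] (σ x) = σ ((value f)^[n] x) :=
  ((show Function.Semiconj σ (value f) (value f) from
    fun x => (value_map f σ x).symm).iterate_right n x).symm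

/-- The natural action of `Gal(Ω/K)_t` on the tree of preimages of `t`, one automorphism at a
time. -/
def galPerm (f : RatFunc K) {t : Ω} (σ : Ω ≃ₐ[K] Ω) (hσ : σ t = t) :
    Equiv.Perm (PreimageTree f t) where
  toFun p := ⟨(p.1.1, σ p.1.2), by
    have h := p.2
    rw [value_iterate_map, h, hσ]⟩
  invFun p := ⟨(p.1.1, σ.symm p.1.2), by
    have h := p.2
    rw [value_iterate_map, h, AlgEquiv.symm_apply_eq, hσ]⟩
  left_inv p := Subtype.ext (Prod.ext rfl (σ.symm_apply_apply _))
  right_inv p := Subtype.ext (Prod.ext rfl (σ.apply_symm_apply _))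

/-- A choice, for each of the points `t_i ∈ f⁻¹(t)`, of a path from `t` to `t_i`.
Here `Ω` is a separable closure of `K(t)`; it is then also a separable closure of each `K(t_i)`,
as `t = f(t_i)`, and `separableClosure K Ω` is the separable closure of `K` in `Ω`. -/
structure PathSystem (f : RatFunc K) (t : Ω) where
  /-- the enumeration `t_1, …, t_d` of `f⁻¹(t)`, where `d = deg f` -/
  point : Fin (ratDegree f) ≃ {x : Ω // value f x = t}
  /-- the path `λ_i`, a `K^sep`-isomorphism `K(t)^sep → K(t_i)^sep` -/
  path : Fin (ratDegree f) → (Ω ≃ₐ[separableClosure K Ω] Ω)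
  path_apply : ∀ i, path i t = (point i).1

namespace PathSystem

variable {f : RatFunc K} {t : Ω} (Λ : PathSystem f t)

/-- The point `t_v` over `t` labelled by the word `v = i_1 … i_n`, that is,
`λ_{i_1} (λ_{i_2} (… λ_{i_n} (t)))`. -/
def pt : List (Fin (ratDegree f)) → Ω
  | [] => t
  | i :: v => Λ.path i (pt v)

/-- The path `λ_i` as a `K`-automorphism. -/
def pathK (i : Fin (ratDegree f)) : Ω ≃ₐ[K] Ω := (Λ.path i).restrictScalars K

theorem iterate_path (i : Fin (ratDegree f)) (n : ℕ) (x : Ω) :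
    (value f)^[n] (Λ.path i x) = Λ.path i ((value f)^[n] x) :=
  value_iterate_map f (Λ.pathK i) n x

theorem value_path (i : Fin (ratDegree f)) : value f (Λ.path i t) = t := by
  rw [Λ.path_apply]; exact (Λ.point i).2

theorem iterate_pt_append (v w : List (Fin (ratDegree f))) :
    (value f)^[w.length] (Λ.pt (v ++ w)) = Λ.pt v := by
  induction v with
  | nil =>
    induction w with
    | nil => rfl
    | cons i w ih =>
      simp only [List.nil_append] at ih
      simp only [List.nil_append, List.length_cons, pt, Function.iterate_succ_apply',
        iterate_path, ih, value_path]
  | cons i v ih => rw [List.cons_append, pt, pt, iterate_path, ih]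

theorem iterate_pt (v : List (Fin (ratDegree f))) : (value f)^[v.length] (Λ.pt v) = t :=
  Λ.iterate_pt_append [] v

theorem pt_injective : ∀ v w : List (Fin (ratDegree f)), v.length = w.length →
    Λ.pt v = Λ.pt w → v = w
  | [], w, h, _ => (List.length_eq_zero_iff.1 h.symm).symm
  | i :: v, [], h, _ => by simp at h
  | i :: v, j :: w, h, e => by
    have hl : v.length = w.length := by simpa using h
    have key : Λ.path i t = Λ.path j t := by
      have h1 := congrArg ((value f)^[v.length]) e
      rw [pt, pt, iterate_path, iterate_path, iterate_pt, hl, iterate_pt] at h1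
      exact h1
    have hij : i = j := by
      rw [Λ.path_apply, Λ.path_apply] at key
      exact Λ.point.injective (Subtype.ext key)
    subst hij
    rw [pt_injective v w hl ((Λ.path i).injective e)]

theorem pt_surjective : ∀ (n : ℕ) (x : Ω), (value f)^[n] x = t →
    ∃ v : List (Fin (ratDegree f)), v.length = n ∧ Λ.pt v = x
  | 0, x, h => ⟨[], rfl, h.symm⟩
  | n + 1, x, h => by
    rw [Function.iterate_succ_apply'] at h
    obtain ⟨i, hi⟩ := Λ.point.surjective ⟨_, h⟩
    have h1 : Λ.path i t = (value f)^[n] x := by rw [Λ.path_apply, hi]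
    obtain ⟨v, hv, hx⟩ := pt_surjective n ((Λ.path i).symm x) (by
      apply (Λ.path i).injective
      rw [← iterate_path, AlgEquiv.apply_symm_apply, h1])
    exact ⟨i :: v, by simp [hv], by rw [pt, hx, AlgEquiv.apply_symm_apply]⟩

/-- The identification, determined by the paths, of the `d`-adic tree of words with the tree of
preimages of `t`. -/
noncomputable def label : List (Fin (ratDegree f)) ≃ PreimageTree f t :=
  Equiv.ofBijective (fun v => ⟨(v.length, Λ.pt v), Λ.iterate_pt v⟩) <| by
    constructor
    · intro v w h
      have h' := congrArg Subtype.val h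
      simp only [Prod.mk.injEq] at h'
      exact Λ.pt_injective v w h'.1 h'.2
    · rintro ⟨⟨n, x⟩, h⟩
      obtain ⟨v, hv, hx⟩ := Λ.pt_surjective n x h
      exact ⟨v, Subtype.ext (Prod.ext hv hx)⟩

theorem label_val (v : List (Fin (ratDegree f))) : (Λ.label v).1 = (v.length, Λ.pt v) := rfl

theorem label_symm_length (p : PreimageTree f t) : (Λ.label.symm p).length = p.1.1 := by
  conv_rhs => rw [← Λ.label.apply_symm_apply p, label_val]

theorem pt_label_symm (p : PreimageTree f t) : Λ.pt (Λ.label.symm p) = p.1.2 := by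
  conv_rhs => rw [← Λ.label.apply_symm_apply p, label_val]

theorem prefix_iff (v w : List (Fin (ratDegree f))) :
    v <+: w ↔ v.length ≤ w.length ∧ (value f)^[w.length - v.length] (Λ.pt w) = Λ.pt v := by
  constructor
  · rintro ⟨u, rfl⟩
    refine ⟨by simp, ?_⟩
    rw [List.length_append, Nat.add_sub_cancel_left, iterate_pt_append]
  · rintro ⟨hle, h⟩
    have hd : (w.drop v.length).length = w.length - v.length := by simp
    have e := Λ.iterate_pt_append (w.take v.length) (w.drop v.length)
    rw [List.take_append_drop, hd, h] at e
    have := Λ.pt_injective _ _ (by simp [hle]) e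
    rw [this]
    exact List.take_prefix _ _

/-- The automorphism of the tree of words induced by a `K`-automorphism fixing `t`. -/
noncomputable def treeAut (σ : Ω ≃ₐ[K] Ω) (hσ : σ t = t) : TreeAut (Fin (ratDegree f)) :=
  ⟨(Λ.label.trans (galPerm f σ hσ)).trans Λ.label.symm, by
    have hlen : ∀ v, (((Λ.label.trans (galPerm f σ hσ)).trans Λ.label.symm) v).length
        = v.length := fun v => by
      rw [Equiv.trans_apply, label_symm_length]; rfl
    have hpt : ∀ v, Λ.pt (((Λ.label.trans (galPerm f σ hσ)).trans Λ.label.symm) v)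
        = σ (Λ.pt v) := fun v => by
      rw [Equiv.trans_apply, pt_label_symm]; rfl
    refine ⟨hlen, fun v w => ?_⟩
    rw [Λ.prefix_iff, Λ.prefix_iff, hlen, hlen, hpt, hpt, value_iterate_map,
      EmbeddingLike.apply_eq_iff_eq]⟩

theorem pt_treeAut (σ : Ω ≃ₐ[K] Ω) (hσ : σ t = t) (v : List (Fin (ratDegree f))) :
    Λ.pt ((Λ.treeAut σ hσ).1 v) = σ (Λ.pt v) :=
  Λ.pt_label_symm (galPerm f σ hσ (Λ.label v))

section Galois

variable (F : Type*) [Field F] [Algebra K F] [Algebra F Ω] [IsScalarTower K F Ω]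

theorem gal_fix (σ : Ω ≃ₐ[IntermediateField.adjoin F {t}] Ω) :
    ((σ.restrictScalars F).restrictScalars K) t = t :=
  σ.commutes ⟨t, IntermediateField.mem_adjoin_simple_self F t⟩

/-- The arboreal Galois representation `ρ : Gal(F(t)^sep/F(t)) → Aut T`, for a field `F` over
`K` with `F ⊆ K^sep`, so that `Ω` is a separable closure of `F(t)`; the tree of preimages of `t`
is identified with the tree of words by the chosen paths. -/
noncomputable def rho :
    (Ω ≃ₐ[IntermediateField.adjoin F {t}] Ω) →* TreeAut (Fin (ratDegree f)) where
  toFun σ := Λ.treeAut ((σ.restrictScalars F).restrictScalars K) (gal_fix F σ)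
  map_one' := by
    refine Subtype.ext (Equiv.ext fun v => ?_)
    exact Λ.label.symm_apply_apply v
  map_mul' σ τ := by
    refine Subtype.ext (Equiv.ext fun v => ?_)
    change _ = Λ.label.symm (galPerm f _ (gal_fix F σ)
      (Λ.label (Λ.label.symm (galPerm f _ (gal_fix F τ) (Λ.label v)))))
    rw [Equiv.apply_symm_apply]
    rfl

/-- The iterated Galois group `G_∞(F, f, t)`. -/
noncomputable def iteratedGaloisGroup : Subgroup (TreeAut (Fin (ratDegree f))) :=
  (Λ.rho F).range

end Galois

end PathSystem

/-- The splitting field `K_n(f,t)` over `K(t)` of the iterates `f^k` with `k ≤ n`, that is, the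
field generated over `K(t)` by all the preimages of `t` under these iterates. -/
noncomputable def splittingField (f : RatFunc K) (t : Ω) (n : ℕ∞) : IntermediateField K Ω :=
  IntermediateField.adjoin K
    ({t} ∪ {x : Ω | ∃ k : ℕ, (k : ℕ∞) ≤ n ∧ (value f)^[k] x = t})

/-- The field `L_n = K^sep ∩ K_n(f,t)`. -/
noncomputable def constantField (f : RatFunc K) (t : Ω) (n : ℕ∞) : IntermediateField K Ω :=
  separableClosure K Ω ⊓ splittingField f t n

end Preimages

end Arboreal

/-! Since `t_{vw} = λ_v (t_w)`, where `λ_v` is the composite of the paths along `v`, the section at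
`v` of the tree automorphism `g` induced by `σ` is induced by `λ_{g(v)}⁻¹ σ λ_v` (`sec_treeAut`).
Paths fix `K^sep` pointwise and `σ` preserves it, so every section acts on `K^sep` exactly as `σ`
does (`conjAlong_apply_of_mem`). Hence a quotient of two sections fixes `K^sep ⊇ L_n` and lies in
`G_∞(L_n, f, t)`. The same formula gives self-similarity.

Normality comes from the Galois stability of `L_n`. Nontriviality comes from `[F(t_i) : F(t)] = d ≥
2` with `F = L_n`. Paths exist because the fibre over `t` has exactly `d` points and each
isomorphism `K^sep(t) ≅ K^sep(t_i)` extends to separable closures. -/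

namespace Arboreal

open Polynomial IntermediateField

/-! ### Separable closures and their uniqueness -/

section SepClosure

theorem isSepClosure_of_le {K Ω : Type*} [Field K] [Field Ω] [Algebra K Ω]
    {E E' : IntermediateField K Ω} (h : E ≤ E') [hE : IsSepClosure E Ω] : IsSepClosure E' Ω := by
  let _ : Algebra E E' := (IntermediateField.inclusion h).toAlgebra
  have : IsScalarTower E E' Ω := IsScalarTower.of_algebraMap_eq fun _ => rfl
  exact ⟨hE.sep_closed, Algebra.isSeparable_tower_top_of_isSeparable E E' Ω⟩

theorem exists_ringEquiv_of_isSepClosure {A B M N : Type*} [Field A] [Field B] [Field M] [Field N]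
    [Algebra A M] [Algebra B N] [IsSepClosure A M] [hN : IsSepClosure B N] (e : A ≃+* B) :
    ∃ φ : M ≃+* N, ∀ a, φ (algebraMap A M a) = algebraMap B N (e a) := by
  let _ : Algebra A N := ((algebraMap B N).comp e.toRingHom).toAlgebra
  have : Algebra.IsSeparable A N :=
    Algebra.IsSeparable.of_equiv_equiv e.symm (RingEquiv.refl N) <| by
      ext b
      change algebraMap B N (e (e.symm b)) = _
      simp
  have : IsSepClosure A N := ⟨hN.sep_closed, inferInstance⟩
  exact ⟨(IsSepClosure.equiv A M N).toRingEquiv, fun a => (IsSepClosure.equiv A M N).commutes a⟩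

end SepClosure

/-! ### The fibre over a transcendental point -/

section Fibre

variable {K Ω : Type*} [Field K] [Field Ω] [Algebra K Ω]

theorem aeval_num_ne_zero_or (f : RatFunc K) (x : Ω) (h : aeval x f.denom = 0) :
    aeval x f.num ≠ 0 := by
  intro h'
  obtain ⟨a, b, hab⟩ := f.isCoprime_num_denom
  have := congrArg (aeval x) hab
  simp [h, h'] at this

theorem aeval_mem_of_mem {F : Type*} [Field F] [Algebra K F] [Algebra F Ω] [IsScalarTower K F Ω]
    (E : IntermediateField F Ω) {s : Ω} (hs : s ∈ E) (p : K[X]) : aeval s p ∈ E := by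
  rw [← aeval_map_algebraMap F s p]
  exact aeval_algebraMap_apply Ω (⟨s, hs⟩ : E) (p.map (algebraMap K F)) ▸ Subtype.prop _

theorem isAlgebraic_aeval {x : Ω} (hx : IsAlgebraic K x) (p : K[X]) :
    IsAlgebraic K (aeval x p) :=
  mem_algebraicClosure_iff.1 <|
    aeval_mem_of_mem (algebraicClosure K Ω) (mem_algebraicClosure_iff.2 hx) p

/-- Values at algebraic points are algebraic, including the default value `0` at a pole. -/
theorem transcendental_of_value_eq {f : RatFunc K} {s t : Ω} (ht : Transcendental K t)
    (h : value f s = t) : Transcendental K s := by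
  intro hs
  apply ht
  rw [← h, value, div_eq_mul_inv]
  exact (isAlgebraic_aeval hs _).mul (isAlgebraic_aeval hs _).inv

/-- Poles satisfy neither side: the default value `0` differs from `t`, and the numerator does not
vanish there by coprimality. -/
theorem value_eq_iff (f : RatFunc K) {t : Ω} (ht : t ≠ 0) (x : Ω) :
    value f x = t ↔ aeval x f.num = t * aeval x f.denom := by
  by_cases h : aeval x f.denom = 0
  · simp [value, h, ht.symm, aeval_num_ne_zero_or f x h]
  · rw [value, div_eq_iff h]

/-- The polynomial whose roots are the preimages of `t` under `f`. -/
noncomputable def fibrePoly (f : RatFunc K) (t : Ω) : Polynomial Ω :=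
  f.num.map (algebraMap K Ω) - C t * f.denom.map (algebraMap K Ω)

theorem aeval_fibrePoly {A : Type*} [Field A] [Algebra K A] [Algebra Ω A] [IsScalarTower K Ω A]
    (f : RatFunc K) (t : Ω) (x : A) :
    aeval x (fibrePoly f t) = aeval x f.num - algebraMap Ω A t * aeval x f.denom := by
  simp [fibrePoly, aeval_map_algebraMap]

theorem natDegree_fibrePoly (f : RatFunc K) {t : Ω} (ht : Transcendental K t) :
    (fibrePoly f t).natDegree = ratDegree f := by
  refine le_antisymm ?_ ?_
  · refine (natDegree_sub_le _ _).trans (max_le_max ?_ ?_)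
    · exact natDegree_map_le
    · exact (natDegree_C_mul_le _ _).trans natDegree_map_le
  · apply le_natDegree_of_ne_zero
    intro h
    have h1 : aeval t (C (f.num.coeff (ratDegree f)) - C (f.denom.coeff (ratDegree f)) * X) = 0 := by
      simpa [fibrePoly, mul_comm t] using h
    have h2 := (transcendental_iff.1 ht) _ h1
    have h3 := congrArg (fun p => p.coeff 0) h2
    have h4 := congrArg (fun p => p.coeff 1) h2
    simp [coeff_C] at h3 h4
    -- The coefficient in degree `d` is `a - t b` with `a, b` in `K`, so its vanishing forces `a = b
    -- = 0`. This kills a leading coefficient; if it is that of the numerator, then `d = 0` and the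
    -- denominator vanishes as well.
    rcases max_choice f.num.natDegree f.denom.natDegree with h5 | h5
    · rw [ratDegree, h5, coeff_natDegree, leadingCoeff_eq_zero] at h3
      have h6 : f.denom.natDegree = 0 := by rw [h3] at h5; simpa using h5
      rw [ratDegree, h5, h3, natDegree_zero] at h4
      rw [← h6, coeff_natDegree, leadingCoeff_eq_zero] at h4
      exact f.denom_ne_zero h4
    · rw [ratDegree, h5, coeff_natDegree, leadingCoeff_eq_zero] at h4
      exact f.denom_ne_zero h4

/-- At a double root `x`, with `f = p/q`, both `p(x) = t q(x)` and `p'(x) = t q'(x)` hold.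
Eliminating `t` makes `x` a root of `p' q - p q' ≠ 0`, so `x`, and with it `t = f(x)`, would be
algebraic over `K`. -/
theorem separable_fibrePoly {f : RatFunc K} (hf : IsSeparableMap f) {t : Ω}
    (ht : Transcendental K t) : (fibrePoly f t).Separable := by
  rw [separable_def, isCoprime_iff_aeval_ne_zero_of_isAlgClosed Ω (AlgebraicClosure Ω)]
  intro x
  by_contra! hx
  obtain ⟨h1, h2⟩ := hx
  rw [aeval_fibrePoly, sub_eq_zero] at h1
  have h2 : aeval x (derivative f.num)
      = algebraMap Ω (AlgebraicClosure Ω) t * aeval x (derivative f.denom) := by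
    rw [fibrePoly] at h2
    simpa [derivative_map, aeval_map_algebraMap, sub_eq_zero] using h2
  have hx : IsAlgebraic K x := ⟨_, hf, by
    simp only [map_sub, map_mul, h1, h2]
    ring⟩
  have hd : aeval x f.denom ≠ 0 := fun h => aeval_num_ne_zero_or f x h (by rw [h1, h, mul_zero])
  refine transcendental_of_value_eq (f := f) (s := x)
    (t := algebraMap Ω (AlgebraicClosure Ω) t) ?_ ?_ hx
  · exact (transcendental_algebraMap_iff (FaithfulSMul.algebraMap_injective _ _)).2 ht
  · rw [value, h1, mul_div_cancel_right₀ _ hd]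

theorem card_fibre [IsSepClosed Ω] {f : RatFunc K} (hf : IsSeparableMap f) {t : Ω}
    (ht : Transcendental K t) : Nat.card {x : Ω // value f x = t} = ratDegree f := by
  classical
  have hs := separable_fibrePoly hf ht
  have hset : {x : Ω | value f x = t} = ((fibrePoly f t).roots.toFinset : Set Ω) := by
    ext x
    have ht0 : t ≠ 0 := fun h => ht (h ▸ isAlgebraic_zero)
    have := aeval_fibrePoly f t x
    rw [coe_aeval_eq_eval] at this
    simp [value_eq_iff f ht0, mem_roots hs.ne_zero, this, sub_eq_zero, IsRoot.def]
  change Nat.card ({x : Ω | value f x = t} : Set Ω) = _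
  rw [hset, Nat.card_coe_set_eq, Set.ncard_coe_finset,
    Multiset.toFinset_card_of_nodup (nodup_roots hs),
    ← (IsSepClosed.splits_of_separable _ hs).natDegree_eq_card_roots, natDegree_fibrePoly f ht]

end Fibre

/-! ### Existence of systems of paths -/

section Paths

variable {K Ω : Type*} [Field K] [Field Ω] [Algebra K Ω]

theorem transcendental_separableClosure {s : Ω} (hs : Transcendental K s) :
    Transcendental (separableClosure K Ω) s :=
  fun h => hs (h.restrictScalars K)

theorem value_mem_of_mem {F : Type*} [Field F] [Algebra K F] [Algebra F Ω] [IsScalarTower K F Ω]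
    (E : IntermediateField F Ω) (f : RatFunc K) {s : Ω} (hs : s ∈ E) : value f s ∈ E :=
  E.div_mem (aeval_mem_of_mem E hs _) (aeval_mem_of_mem E hs _)

theorem isSepClosure_adjoin (F : Type*) [Field F] [Algebra K F] [Algebra F Ω]
    [IsScalarTower K F Ω] {s t : Ω} (h : t ∈ F⟮s⟯) [IsSepClosure K⟮t⟯ Ω] : IsSepClosure F⟮s⟯ Ω :=
  isSepClosure_of_le (E := K⟮t⟯) (E' := F⟮s⟯.restrictScalars K)
    (adjoin_le_iff.2 (by simpa using h))

/-- Over `S = K^sep` both `t` and `s` are transcendental, so `t ↦ s` defines `S(t) ≅ S(s)`. As `t ∈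
S(s)`, `Ω` is a separable closure of both fields, and the isomorphism extends. -/
theorem exists_path (f : RatFunc K) {s t : Ω} (ht : Transcendental K t) (h : value f s = t)
    [IsSepClosure K⟮t⟯ Ω] : ∃ φ : Ω ≃ₐ[separableClosure K Ω] Ω, φ t = s := by
  set S := separableClosure K Ω
  have : IsSepClosure S⟮t⟯ Ω := isSepClosure_adjoin (K := K) S (mem_adjoin_simple_self S t)
  have : IsSepClosure S⟮s⟯ Ω := isSepClosure_adjoin (K := K) (t := t) S
    (h ▸ value_mem_of_mem S⟮s⟯ f (mem_adjoin_simple_self S s))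
  have ht' := transcendental_separableClosure ht
  have hs' := transcendental_separableClosure (transcendental_of_value_eq ht h)
  let e : S⟮t⟯ ≃ₐ[S] S⟮s⟯ :=
    (RatFunc.algEquivOfTranscendental t ht').symm.trans (RatFunc.algEquivOfTranscendental s hs')
  obtain ⟨φ, hφ⟩ := exists_ringEquiv_of_isSepClosure (M := Ω) (N := Ω) e.toRingEquiv
  refine ⟨AlgEquiv.ofRingEquiv (f := φ) fun x => ?_, ?_⟩
  · rw [IsScalarTower.algebraMap_apply S S⟮t⟯ Ω, hφ]
    change algebraMap S⟮s⟯ Ω (e (algebraMap S S⟮t⟯ x)) = _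
    rw [e.commutes]
    rfl
  · refine (hφ (AdjoinSimple.gen S t)).trans ?_
    change algebraMap S⟮s⟯ Ω (e (AdjoinSimple.gen S t)) = _
    change algebraMap S⟮s⟯ Ω (RatFunc.algEquivOfTranscendental s hs'
      ((RatFunc.algEquivOfTranscendental t ht').symm (AdjoinSimple.gen S t))) = _
    rw [RatFunc.algEquivOfTranscendental_symm_gen t ht']
    exact RatFunc.algEquivOfTranscendental_X s hs'

theorem nonempty_pathSystem {f : RatFunc K} (hdeg : ratDegree f ≠ 0) (hf : IsSeparableMap f)
    {t : Ω} (ht : Transcendental K t) [hΩ : IsSepClosure K⟮t⟯ Ω] : Nonempty (PathSystem f t) := by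
  have := hΩ.sep_closed
  have hcard := card_fibre hf ht
  have : Finite {x : Ω // value f x = t} := Nat.finite_of_card_ne_zero (hcard ▸ hdeg)
  let e := (Finite.equivFinOfCardEq hcard).symm
  choose φ hφ using fun i => exists_path f ht (e i).2
  exact ⟨⟨e, φ, hφ⟩⟩

end Paths

/-! ### The degree of a rational function as a field degree -/

section Degree

theorem finrank_adjoin_map {K S : Type*} [Field K] [Field S] [Algebra K S] (f : RatFunc K) :
    Module.finrank S⟮(algebraMap S[X] (RatFunc S) (f.num.map (algebraMap K S)) /
      algebraMap S[X] (RatFunc S) (f.denom.map (algebraMap K S)))⟯ (RatFunc S) = ratDegree f := by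
  classical
  have hq : f.denom.map (algebraMap K S) ≠ 0 := Polynomial.map_ne_zero f.denom_ne_zero
  have hc : IsCoprime (f.num.map (algebraMap K S)) (f.denom.map (algebraMap K S)) :=
    f.isCoprime_num_denom.map (mapRingHom (algebraMap K S))
  have hg : gcd (f.num.map (algebraMap K S)) (f.denom.map (algebraMap K S)) = 1 := by
    rw [← normalize_gcd, normalize_eq_one]
    exact (gcd_isUnit_iff _ _).2 hc
  rw [RatFunc.finrank_eq_max_natDegree, RatFunc.num_div, RatFunc.denom_div _ hq, hg]
  -- `RatFunc.num_div` and `RatFunc.denom_div` rescale by this nonzero constant, which leaves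
  -- degrees unchanged.
  have hl : (f.denom.map (algebraMap K S)).leadingCoeff⁻¹ ≠ 0 :=
    inv_ne_zero (leadingCoeff_ne_zero.2 hq)
  simp [natDegree_C_mul, ratDegree, f.denom_ne_zero]

variable {K Ω : Type*} [Field K] [Field Ω] [Algebra K Ω]

/-- Under `F(X) ≅ F(s)`, membership would give `F(f) = F(X)`, an extension of degree `1` instead of
`d`. -/
theorem notMem_adjoin_value {F : Type*} [Field F] [Algebra K F] [Algebra F Ω]
    [IsScalarTower K F Ω] (f : RatFunc K) (hdeg : 2 ≤ ratDegree f) {s : Ω}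
    (hs : Transcendental F s) : s ∉ F⟮value f s⟯ := by
  intro hmem
  set r : RatFunc F := algebraMap F[X] (RatFunc F) (f.num.map (algebraMap K F)) /
      algebraMap F[X] (RatFunc F) (f.denom.map (algebraMap K F)) with hr
  have hfr : Module.finrank F⟮r⟯ (RatFunc F) = ratDegree f := finrank_adjoin_map f
  let φ : RatFunc F →ₐ[F] Ω :=
    (F⟮s⟯).val.comp (RatFunc.algEquivOfTranscendental s hs).toAlgHom
  have hφ : ∀ p : F[X], φ (algebraMap F[X] (RatFunc F) p) = aeval s p := fun p => by
    simp [φ, RatFunc.algEquivOfTranscendental_algebraMap]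
  have hφX : φ RatFunc.X = s := by simp [φ]
  have hφr : φ r = value f s := by
    rw [hr, map_div₀, hφ, hφ, aeval_map_algebraMap, aeval_map_algebraMap, value]
  have hX : (RatFunc.X : RatFunc F) ∈ F⟮r⟯ := by
    have : φ RatFunc.X ∈ F⟮r⟯.map φ := by
      rw [adjoin_map, Set.image_singleton, hφr, hφX]
      exact hmem
    obtain ⟨y, hy, hyX⟩ := this
    exact φ.injective hyX ▸ hy
  have htop : F⟮r⟯ = ⊤ := by
    rw [eq_top_iff, ← RatFunc.adjoin_X]
    exact adjoin_simple_le_iff.2 hX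
  rw [htop, IntermediateField.finrank_top] at hfr
  omega

end Degree

/-! ### Sections as conjugates along paths -/

section Sections

variable {K Ω : Type*} [Field K] [Field Ω] [Algebra K Ω]

namespace PathSystem

variable {f : RatFunc K} {t : Ω} (Λ : PathSystem f t)

theorem eq_of_pt_eq {g h : TreeAut (Fin (ratDegree f))}
    (H : ∀ v, Λ.pt (g.1 v) = Λ.pt (h.1 v)) : g = h :=
  Subtype.ext <| Equiv.ext fun v =>
    Λ.pt_injective _ _ ((g.2.1 v).trans (h.2.1 v).symm) (H v)

theorem treeAut_mul (σ τ : Ω ≃ₐ[K] Ω) (hσ : σ t = t) (hτ : τ t = t) (h : (σ * τ) t = t) :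
    Λ.treeAut (σ * τ) h = Λ.treeAut σ hσ * Λ.treeAut τ hτ := by
  refine Λ.eq_of_pt_eq fun v => ?_
  change _ = Λ.pt ((Λ.treeAut σ hσ).1 ((Λ.treeAut τ hτ).1 v))
  rw [pt_treeAut, pt_treeAut, pt_treeAut, AlgEquiv.mul_apply]

theorem inv_fix {σ : Ω ≃ₐ[K] Ω} (hσ : σ t = t) : σ⁻¹ t = t := by
  rw [AlgEquiv.aut_inv, AlgEquiv.symm_apply_eq, hσ]

theorem treeAut_inv (σ : Ω ≃ₐ[K] Ω) (hσ : σ t = t) :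
    (Λ.treeAut σ hσ)⁻¹ = Λ.treeAut σ⁻¹ (inv_fix hσ) := by
  rw [inv_eq_iff_mul_eq_one, ← treeAut_mul (h := by simp)]
  refine Λ.eq_of_pt_eq fun v => ?_
  rw [pt_treeAut, mul_inv_cancel]
  rfl

/-- The composite `λ_{i_1} ∘ … ∘ λ_{i_n}` of paths along the word `i_1 … i_n`. -/
noncomputable def wordPath : List (Fin (ratDegree f)) → (Ω ≃ₐ[separableClosure K Ω] Ω)
  | [] => AlgEquiv.refl
  | i :: v => (wordPath v).trans (Λ.path i)

theorem pt_append (v w : List (Fin (ratDegree f))) :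
    Λ.pt (v ++ w) = Λ.wordPath v (Λ.pt w) := by
  induction v with
  | nil => rfl
  | cons i v ih => rw [List.cons_append, pt, ih]; rfl

theorem wordPath_apply (v : List (Fin (ratDegree f))) : Λ.wordPath v t = Λ.pt v := by
  rw [← List.append_nil v, pt_append, List.append_nil]; rfl

/-- The automorphism `λ_w⁻¹ ∘ σ ∘ λ_v`; it induces the section at `v` of the tree automorphism
induced by `σ` when `w` is the image of `v`. -/
noncomputable def conjAlong (σ : Ω ≃ₐ[K] Ω) (v w : List (Fin (ratDegree f))) : Ω ≃ₐ[K] Ω :=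
  (((Λ.wordPath v).restrictScalars K).trans σ).trans ((Λ.wordPath w).symm.restrictScalars K)

theorem conjAlong_apply (σ : Ω ≃ₐ[K] Ω) (v w : List (Fin (ratDegree f))) (x : Ω) :
    Λ.conjAlong σ v w x = (Λ.wordPath w).symm (σ (Λ.wordPath v x)) := rfl

theorem conjAlong_fix (σ : Ω ≃ₐ[K] Ω) (hσ : σ t = t) (v : List (Fin (ratDegree f))) :
    Λ.conjAlong σ v ((Λ.treeAut σ hσ).1 v) t = t := by
  rw [conjAlong_apply, AlgEquiv.symm_apply_eq, wordPath_apply, wordPath_apply, pt_treeAut]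

theorem sec_treeAut (σ : Ω ≃ₐ[K] Ω) (hσ : σ t = t) (v : List (Fin (ratDegree f))) :
    TreeAut.sec (Λ.treeAut σ hσ) v =
      Λ.treeAut (Λ.conjAlong σ v ((Λ.treeAut σ hσ).1 v)) (Λ.conjAlong_fix σ hσ v) := by
  refine Λ.eq_of_pt_eq fun w => ?_
  rw [pt_treeAut, conjAlong_apply, ← pt_append, ← pt_treeAut Λ σ hσ, TreeAut.apply_append,
    pt_append, AlgEquiv.symm_apply_apply]

theorem map_mem_separableClosure (σ : Ω ≃ₐ[K] Ω) {x : Ω} (hx : x ∈ separableClosure K Ω) :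
    σ x ∈ separableClosure K Ω :=
  (map_mem_separableClosure_iff σ.toAlgHom).2 hx

theorem conjAlong_apply_of_mem (σ : Ω ≃ₐ[K] Ω) (v w : List (Fin (ratDegree f))) {x : Ω}
    (hx : x ∈ separableClosure K Ω) : Λ.conjAlong σ v w x = σ x := by
  have h1 : Λ.wordPath v x = x := (Λ.wordPath v).commutes ⟨x, hx⟩
  have h2 : Λ.wordPath w (σ x) = σ x :=
    (Λ.wordPath w).commutes ⟨σ x, map_mem_separableClosure σ hx⟩
  rw [conjAlong_apply, h1, AlgEquiv.symm_apply_eq, h2]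

/-- Describes every `G_∞(F, f, t)` inside the single group of `K`-automorphisms of `Ω`, where
composing with paths, which move `t`, makes sense. -/
theorem mem_iteratedGaloisGroup_iff (F : Type*) [Field F] [Algebra K F] [Algebra F Ω]
    [IsScalarTower K F Ω] (g : TreeAut (Fin (ratDegree f))) :
    g ∈ Λ.iteratedGaloisGroup F ↔ ∃ (σ : Ω ≃ₐ[K] Ω) (hσ : σ t = t),
      (∀ x : F, σ (algebraMap F Ω x) = algebraMap F Ω x) ∧ Λ.treeAut σ hσ = g := by
  constructor
  · rintro ⟨σ, rfl⟩
    exact ⟨(σ.restrictScalars F).restrictScalars K, gal_fix F σ,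
      fun x => (σ.restrictScalars F).commutes x, rfl⟩
  · rintro ⟨σ, hσ, hF, rfl⟩
    have hfix : ∀ x ∈ F⟮t⟯, σ x = x := fun x hx => by
      induction hx using adjoin_induction with
      | mem x hx => rw [Set.mem_singleton_iff.1 hx, hσ]
      | algebraMap x => exact hF x
      | add x y _ _ hx hy => rw [map_add, hx, hy]
      | inv x _ hx => rw [map_inv₀, hx]
      | mul x y _ _ hx hy => rw [map_mul, hx, hy]
    exact ⟨AlgEquiv.ofRingEquiv (f := σ.toRingEquiv) fun x => hfix x x.2, rfl⟩

theorem isSelfSimilar_iteratedGaloisGroup (F : Type*) [Field F] [Algebra K F] [Algebra F Ω]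
    [IsScalarTower K F Ω] (hF : ∀ x : F, algebraMap F Ω x ∈ separableClosure K Ω) :
    IsSelfSimilar (Λ.iteratedGaloisGroup F) := by
  intro g hg v
  obtain ⟨σ, hσ, hσF, rfl⟩ := (Λ.mem_iteratedGaloisGroup_iff F g).1 hg
  rw [sec_treeAut, mem_iteratedGaloisGroup_iff]
  exact ⟨_, _, fun x => by rw [conjAlong_apply_of_mem _ _ _ _ (hF x), hσF], rfl⟩

theorem iteratedGaloisGroup_le (F : Type*) [Field F] [Algebra K F] [Algebra F Ω]
    [IsScalarTower K F Ω] : Λ.iteratedGaloisGroup F ≤ Λ.iteratedGaloisGroup K := by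
  intro g hg
  rw [mem_iteratedGaloisGroup_iff] at hg ⊢
  obtain ⟨σ, hσ, -, h⟩ := hg
  exact ⟨σ, hσ, σ.commutes, h⟩

theorem normal_iteratedGaloisGroup (E : IntermediateField K Ω)
    (hE : ∀ σ : Ω ≃ₐ[K] Ω, σ t = t → ∀ x ∈ E, σ x ∈ E) :
    ((Λ.iteratedGaloisGroup E).subgroupOf (Λ.iteratedGaloisGroup K)).Normal := by
  constructor
  rintro ⟨h, _⟩ hh ⟨g, hg⟩
  rw [Subgroup.mem_subgroupOf] at hh ⊢
  change g * h * g⁻¹ ∈ _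
  obtain ⟨σ, hσ, -, rfl⟩ := (Λ.mem_iteratedGaloisGroup_iff K g).1 hg
  obtain ⟨τ, hτ, hτE, rfl⟩ := (Λ.mem_iteratedGaloisGroup_iff E h).1 hh
  rw [mem_iteratedGaloisGroup_iff]
  have h1 : (σ * τ) t = t := by rw [AlgEquiv.mul_apply, hτ, hσ]
  have h2 : (σ * τ * σ⁻¹) t = t := by rw [AlgEquiv.mul_apply, inv_fix hσ, h1]
  refine ⟨σ * τ * σ⁻¹, h2, fun x => ?_, ?_⟩
  · have := hτE ⟨σ⁻¹ x.1, hE _ (inv_fix hσ) _ x.2⟩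
    change σ (τ (σ⁻¹ x.1)) = x.1
    rw [show τ (σ⁻¹ x.1) = σ⁻¹ x.1 from this]
    exact σ.apply_symm_apply _
  · rw [treeAut_mul _ _ _ h1 (inv_fix hσ), treeAut_mul _ _ _ hσ hτ, treeAut_inv]

/-- A trivial image would fix a first-level point `t_i`, so `t_i ∈ F(t) = F(f(t_i))` by Galois
theory, contradicting `notMem_adjoin_value`. -/
theorem iteratedGaloisGroup_ne_bot (hdeg : 2 ≤ ratDegree f) (ht : Transcendental K t)
    [IsSepClosure K⟮t⟯ Ω] (F : Type*) [Field F] [Algebra K F] [Algebra F Ω]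
    [IsScalarTower K F Ω] [Algebra.IsAlgebraic K F] : Λ.iteratedGaloisGroup F ≠ ⊥ := by
  intro hbot
  let i : Fin (ratDegree f) := ⟨0, by omega⟩
  have hi : value f (Λ.pt [i]) = t := Λ.iterate_pt [i]
  have hs : Transcendental F (Λ.pt [i]) := fun h =>
    transcendental_of_value_eq ht hi (h.restrictScalars K)
  have : IsSepClosure F⟮t⟯ Ω := isSepClosure_adjoin (K := K) F (mem_adjoin_simple_self F t)
  have hmem : Λ.pt [i] ∈ (⊥ : IntermediateField F⟮t⟯ Ω) := by
    rw [InfiniteGalois.mem_bot_iff_fixed]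
    intro σ
    have h1 : Λ.rho F σ = 1 := by
      rw [← Subgroup.mem_bot, ← hbot]
      exact ⟨σ, rfl⟩
    have h2 := Λ.pt_treeAut _ (gal_fix F σ) [i]
    rw [show Λ.treeAut _ (gal_fix F σ) = 1 from h1] at h2
    exact h2.symm
  obtain ⟨x, hx⟩ := mem_bot.1 hmem
  refine notMem_adjoin_value f hdeg hs ?_
  rw [hi, ← hx]
  exact x.2

theorem sec_mul_sec_inv_mem (F : Type*) [Field F] [Algebra K F] [Algebra F Ω]
    [IsScalarTower K F Ω] (hF : ∀ x : F, algebraMap F Ω x ∈ separableClosure K Ω)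
    {g : TreeAut (Fin (ratDegree f))} (hg : g ∈ Λ.iteratedGaloisGroup K)
    (v w : List (Fin (ratDegree f))) :
    TreeAut.sec g v * (TreeAut.sec g w)⁻¹ ∈ Λ.iteratedGaloisGroup F := by
  obtain ⟨σ, hσ, -, rfl⟩ := (Λ.mem_iteratedGaloisGroup_iff K g).1 hg
  rw [sec_treeAut, sec_treeAut, treeAut_inv,
    ← treeAut_mul (h := by rw [AlgEquiv.mul_apply, inv_fix (Λ.conjAlong_fix σ hσ w),
      Λ.conjAlong_fix σ hσ v]), mem_iteratedGaloisGroup_iff]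
  refine ⟨_, _, fun x => ?_, rfl⟩
  set σv := Λ.conjAlong σ v ((Λ.treeAut σ hσ).1 v)
  set σw := Λ.conjAlong σ w ((Λ.treeAut σ hσ).1 w) with hσw
  -- On `K^sep` both `σv` and `σw` agree with `σ`, so `σv` may be replaced by `σw` at `σw⁻¹ x`,
  -- which is again in `K^sep`.
  have hy := map_mem_separableClosure σw⁻¹ (hF x)
  rw [AlgEquiv.mul_apply, conjAlong_apply_of_mem _ _ _ _ hy,
    ← Λ.conjAlong_apply_of_mem σ w ((Λ.treeAut σ hσ).1 w) hy, ← hσw]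
  exact σw.apply_symm_apply _

end PathSystem

/-! ### Galois stability of the constant fields -/

theorem map_mem_splittingField (f : RatFunc K) {t : Ω} (n : ℕ∞) (σ : Ω ≃ₐ[K] Ω) (hσ : σ t = t)
    {x : Ω} (hx : x ∈ splittingField f t n) : σ x ∈ splittingField f t n := by
  have hle : splittingField f t n ≤ (splittingField f t n).comap σ.toAlgHom := by
    refine adjoin_le_iff.2 ?_
    rintro x (rfl | ⟨k, hk, hx⟩)
    · exact subset_adjoin K _ (Or.inl hσ)
    · exact subset_adjoin K _ (Or.inr ⟨k, hk, by
        change (value f)^[k] (σ x) = t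
        rw [value_iterate_map, hx, hσ]⟩)
  exact hle hx

theorem map_mem_constantField (f : RatFunc K) {t : Ω} (n : ℕ∞) (σ : Ω ≃ₐ[K] Ω) (hσ : σ t = t)
    {x : Ω} (hx : x ∈ constantField f t n) : σ x ∈ constantField f t n :=
  ⟨PathSystem.map_mem_separableClosure σ hx.1, map_mem_splittingField f n σ hσ hx.2⟩

end Sections

end Arboreal

open Arboreal in
theorem proposition3p2 {K Ω : Type*} [Field K] [Field Ω] [Algebra K Ω]
    (f : RatFunc K) (hdeg : 2 ≤ ratDegree f) (hsep : IsSeparableMap f)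
    (t : Ω) (ht : Transcendental K t) [IsSepClosure (IntermediateField.adjoin K {t}) Ω] :
    Nonempty (PathSystem f t) ∧
    ∀ (Λ : PathSystem f t) (n : ℕ∞), 1 ≤ n →
      IsSelfSimilarPair (Λ.iteratedGaloisGroup K)
        (Λ.iteratedGaloisGroup (constantField f t n)) ∧
      (Λ.iteratedGaloisGroup K : Set (TreeAut (Fin (ratDegree f)))) =
        intermediate (Λ.iteratedGaloisGroup K) (Λ.iteratedGaloisGroup (constantField f t n)) := by
  refine ⟨nonempty_pathSystem (by omega) hsep ht, fun Λ n _ => ?_⟩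
  have hF : ∀ x : constantField f t n,
      algebraMap (constantField f t n) Ω x ∈ separableClosure K Ω := fun x => x.2.1
  have : Algebra.IsAlgebraic K (constantField f t n) := ⟨fun x =>
    (isAlgebraic_algebraMap_iff (FaithfulSMul.algebraMap_injective _ Ω)).1
      (mem_separableClosure_iff.1 (hF x)).isIntegral.isAlgebraic⟩
  refine ⟨⟨?_, ?_, ?_, ?_, ?_⟩, ?_⟩
  · exact Λ.iteratedGaloisGroup_ne_bot hdeg ht _
  · exact Λ.iteratedGaloisGroup_le _
  · exact Λ.normal_iteratedGaloisGroup _ fun σ hσ x hx => map_mem_constantField f n σ hσ hx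
  · exact Λ.isSelfSimilar_iteratedGaloisGroup K fun x => (separableClosure K Ω).algebraMap_mem x
  · exact Λ.isSelfSimilar_iteratedGaloisGroup _ hF
  · exact Set.Subset.antisymm (fun g hg => ⟨hg, Λ.sec_mul_sec_inv_mem _ hF hg⟩) fun g hg => hg.1
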